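/- Let $c>0$ and $\lambda>0$. Let $\{N(t),t\ge 0\}$ be a homogeneous Poisson process with rate $\lambda$, let $V(0)$ be a random variable uniformly distributed on $\{-c,c\}$ and independent of $N$, and let $$V(t)=V(0)(-1)^{N(t)},\qquad X(t)=\int_0^t V(s)\,\mathrm{d}s,\qquad t\ge 0,$$ be the velocity and the position of the telegraph process. For $n\in\{0,1\}$ let $I_n(z)=\sum_{k=0}^\infty \frac{(z/2)^{n+2k}}{k!\,\Gamma(k+n+1)}$ be the modified Bessel function of the first kind, and let $\delta_a$ be the Dirac measure at $a$. Then for every $t\ge 0$ and every $v\in\{-c,c\}$ the following equalities of measures on $\mathbb{R}$ hold: $$\mathbb{P}(X(t)\in \mathrm{d}x,\,V(t)=v\mid V(0)=v)=e^{-\lambda t}\left[\delta_{vt}(\mathrm{d}x)+\frac{\lambda}{2c}\,(ct+x\,\mathrm{sgn}(v))\,\frac{I_1\!\left(\frac{\lambda}{c}\sqrt{c^2t^2-x^2}\right)}{\sqrt{c^2t^2-x^2}}\,\mathbf{1}_{|x|<ct}\,\mathrm{d}x\right]$$ and $$\mathbb{P}(X(t)\in \mathrm{d}x,\,V(t)=v\mid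 V(0)=-v)=e^{-\lambda t}\,\frac{\lambda}{2c}\,I_0\!\left(\frac{\lambda}{c}\sqrt{c^2t^2-x^2}\right)\mathbf{1}_{|x|<ct}\,\mathrm{d}x .$$ -/

import Mathlib

open MeasureTheory ProbabilityTheory
open scoped NNReal ENNReal Nat

noncomputable section

/-- `N` is a homogeneous Poisson (counting) process with rate `r` under `P`: it starts at `0`, has
nondecreasing right-continuous `ℕ`-valued paths (almost surely), independent increments, and
`N t - N s` is Poisson distributed with parameter `r * (t - s)` for `s ≤ t`. -/
structure IsPoissonProcess {Ω : Type*} [MeasurableSpace Ω] (r : ℝ≥0) (N : ℝ≥0 → Ω → ℕ)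
    (P : Measure Ω) : Prop where
  measurable : ∀ t, Measurable (N t)
  init : ∀ᵐ ω ∂P, N 0 ω = 0
  mono : ∀ᵐ ω ∂P, Monotone fun t => N t ω
  rightCont : ∀ᵐ ω ∂P, ∀ t, ContinuousWithinAt (fun s => N s ω) (Set.Ici t) t
  indepIncrements : HasIndepIncrements N P
  law_increment : ∀ s t, s ≤ t →
    HasLaw (fun ω => N t ω - N s ω) (poissonMeasure (r * (t - s))) P

/-- The velocity `V(t) = V(0) (-1) ^ N(t)` of the telegraph process with initial velocity `V₀`. -/
def telegraphVelocity {Ω : Type*} (V₀ : Ω → ℝ) (N : ℝ≥0 → Ω → ℕ) (t : ℝ≥0) (ω : Ω) : ℝ :=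
  V₀ ω * (-1) ^ N t ω

/-- The position `X(t) = ∫₀ᵗ V(s) ds` of the telegraph process. -/
def telegraphPosition {Ω : Type*} (V₀ : Ω → ℝ) (N : ℝ≥0 → Ω → ℕ) (t : ℝ≥0) (ω : Ω) : ℝ :=
  ∫ s in (0 : ℝ)..t, telegraphVelocity V₀ N s.toNNReal ω

/-- The modified Bessel function of the first kind `I_n`, of integer order `n ≥ 0`, at a real
argument. -/
def besselI (n : ℕ) (x : ℝ) : ℝ :=
  ∑' k : ℕ, (x / 2) ^ (n + 2 * k) / ((k ! : ℝ) * Real.Gamma (k + n + 1))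

end

/-! Both sides are finite measures carried by a bounded interval, so it suffices to match their
moment generating functions (`MeasureTheory.Measure.ext_of_mgf_of_ae_abs_le`).

Probabilistic side. Independence of `V₀` and `N` turns conditioning on the initial velocity `w` into
the study of `w * S t`, where `S` integrates the sign `ε = (-1) ^ N`
(`cond_telegraph_eq_positionLaw`). Put `a = E[exp (θ S)]` and `b = E[ε exp (θ S)]`. Differentiating
the exponential gives `a' = θ b`. For `b`, the product `ε_t ε_s` is the sign of an increment,
independent of the past and of mean `exp (-2λ(t - s))`, whence `b' = θ a - 2λ b`. The linear system
is solved with `r² = λ² + θ²` (`integral_exp_unitPosition`). The half sum and half difference of `a`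
and `b` are the transforms on the events `ε = 1` and `ε = -1`.

Analytic side. Expand the Bessel and hyperbolic factors in power series and integrate termwise. Each
term is a beta integral, and the Cauchy product collapses by the binomial theorem to powers of `μ² +
θ²`, that is, to `cosh` and `sinh` of `q R` with `q² = μ² + θ²`. For `I_1` the binomial sum lacks
one end term; the Dirac mass supplies exactly what is missing. -/

/-! ### Power series of the Bessel functions. -/

/-- The entire function `∑ yᵏ / (k! (k + n)!)`, in terms of which `I_n` is expressed. -/
noncomputable def besselSeries (n : ℕ) (y : ℝ) : ℝ :=
  ∑' k : ℕ, y ^ k / ((k ! : ℝ) * ((k + n)! : ℝ))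

lemma summable_besselSeries_norm (n : ℕ) (y : ℝ) :
    Summable fun k : ℕ => ‖y ^ k / ((k ! : ℝ) * ((k + n)! : ℝ))‖ := by
  refine Summable.of_nonneg_of_le (fun _ => norm_nonneg _) (fun k => ?_)
    (Real.summable_pow_div_factorial |y|)
  rw [Real.norm_eq_abs, abs_div, abs_pow, abs_of_pos (by positivity : (0 : ℝ) < k ! * (k + n)!)]
  gcongr
  have : (1 : ℝ) ≤ ((k + n)! : ℝ) := by exact_mod_cast Nat.one_le_iff_ne_zero.2 (Nat.factorial_ne_zero _)
  nlinarith [(by positivity : (0 : ℝ) < (k ! : ℝ))]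

lemma hasSum_besselSeries (n : ℕ) (y : ℝ) :
    HasSum (fun k : ℕ => y ^ k / ((k ! : ℝ) * ((k + n)! : ℝ))) (besselSeries n y) :=
  (summable_besselSeries_norm n y).of_norm.hasSum

lemma besselSeries_nonneg (n : ℕ) {y : ℝ} (hy : 0 ≤ y) : 0 ≤ besselSeries n y :=
  tsum_nonneg fun _ => by positivity

lemma continuous_besselSeries (n : ℕ) : Continuous (besselSeries n) := by
  rw [continuous_iff_continuousAt]
  intro y
  have : ContinuousOn (besselSeries n) (Set.Icc (-(|y| + 1)) (|y| + 1)) := by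
    refine continuousOn_tsum (fun k => by fun_prop)
      (summable_besselSeries_norm n (|y| + 1)) fun k x hx => ?_
    rw [norm_div, norm_div, norm_pow, norm_pow]
    gcongr
    rw [Real.norm_eq_abs, Real.norm_eq_abs, abs_of_nonneg (by positivity : 0 ≤ |y| + 1)]
    exact abs_le.2 hx
  refine this.continuousAt (Icc_mem_nhds ?_ ?_)
  · linarith [neg_abs_le y]
  · linarith [le_abs_self y]

/-- Beyond the prefactor only even powers occur, so substituting a square root leaves a function of
the radicand that is smooth at its zeros. -/
lemma besselI_eq (n : ℕ) (x : ℝ) : besselI n x = (x / 2) ^ n * besselSeries n (x ^ 2 / 4) := by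
  rw [besselI, besselSeries, ← tsum_mul_left]
  refine tsum_congr fun k => ?_
  have : Real.Gamma (k + n + 1) = ((k + n)! : ℝ) := by
    rw [← Nat.cast_add, Real.Gamma_nat_eq_factorial]
  rw [this, pow_add, pow_mul, div_pow x 2 2]
  norm_num
  ring

/-! ### Hyperbolic transforms of the Bessel kernels. -/

/-- A beta integral on a symmetric interval. -/
lemma integral_sq_sub_sq_pow_mul_pow (R : ℝ) (k j : ℕ) :
    ∫ x in (-R)..R, (R ^ 2 - x ^ 2) ^ k * x ^ (2 * j) =
      2 * 4 ^ k * (k ! * (2 * j)! * (j + k)!) / (j ! * (2 * j + 2 * k + 1)!) *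
        R ^ (2 * k + 2 * j + 1) := by
  induction k generalizing j with
  | zero =>
    simp only [pow_zero, one_mul, integral_pow, mul_zero, add_zero, zero_add, mul_one,
      Nat.factorial_zero, Nat.cast_one]
    rw [Nat.factorial_succ, Odd.neg_pow (by simp)]
    have h1 : (j ! : ℝ) ≠ 0 := by positivity
    have h2 : ((2 * j)! : ℝ) ≠ 0 := by positivity
    push_cast
    have h3 : (2 * j + 1 : ℝ) ≠ 0 := by positivity
    field_simp
    ring
  | succ k ih =>
    -- Integration by parts: the integrand is the derivative of `x ^ (2j+1) * (R² - x²) ^ (k+1)`,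
    -- which vanishes at both endpoints. This trades `k + 1` for `j + 1`, hence the induction over
    -- all `j`.
    have key : ∫ x in (-R)..R, ((2 * j + 1 : ℝ) * ((R ^ 2 - x ^ 2) ^ (k + 1) * x ^ (2 * j)) -
        2 * (k + 1) * ((R ^ 2 - x ^ 2) ^ k * x ^ (2 * (j + 1)))) = 0 := by
      have hd : ∀ x ∈ Set.uIcc (-R) R, HasDerivAt
          (fun x : ℝ => x ^ (2 * j + 1) * (R ^ 2 - x ^ 2) ^ (k + 1))
          ((2 * j + 1 : ℝ) * ((R ^ 2 - x ^ 2) ^ (k + 1) * x ^ (2 * j)) -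
            2 * (k + 1) * ((R ^ 2 - x ^ 2) ^ k * x ^ (2 * (j + 1)))) x := by
        intro x _
        convert! (hasDerivAt_pow (2 * j + 1) x).mul
          (((hasDerivAt_pow 2 x).const_sub (R ^ 2)).pow (k + 1)) using 1
        simp only [Pi.pow_apply, Nat.add_sub_cancel, Nat.cast_add, Nat.cast_mul, Nat.cast_ofNat, Nat.cast_one]
        ring
      rw [intervalIntegral.integral_eq_sub_of_hasDerivAt hd
        (Continuous.intervalIntegrable (by fun_prop) _ _)]
      simp
    rw [intervalIntegral.integral_sub (Continuous.intervalIntegrable (by fun_prop) _ _)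
      (Continuous.intervalIntegrable (by fun_prop) _ _), intervalIntegral.integral_const_mul,
      intervalIntegral.integral_const_mul, ih] at key
    have h3 : (2 * j + 1 : ℝ) ≠ 0 := by positivity
    have e1 : ((k + 1)! : ℝ) = (k + 1) * k ! := by push_cast [Nat.factorial_succ]; ring
    have e2 : ((j + 1)! : ℝ) = (j + 1) * j ! := by push_cast [Nat.factorial_succ]; ring
    have e3 : ((2 * (j + 1))! : ℝ) = (2 * j + 2) * ((2 * j + 1) * (2 * j)!) := by
      rw [show 2 * (j + 1) = 2 * j + 1 + 1 by ring, Nat.factorial_succ, Nat.factorial_succ]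
      push_cast; ring
    rw [show j + 1 + k = j + (k + 1) by ring,
      show 2 * (j + 1) + 2 * k + 1 = 2 * j + 2 * (k + 1) + 1 by ring, e2, e3] at key
    rw [e1]
    have h1 : (j ! : ℝ) ≠ 0 := by positivity
    have h2 : ((2 * j + 2 * (k + 1) + 1)! : ℝ) ≠ 0 := by positivity
    have h4 : (j + 1 : ℝ) ≠ 0 := by positivity
    refine mul_left_cancel₀ h3 ?_
    rw [sub_eq_zero] at key
    rw [key]
    field_simp
    ring

/-- Termwise integration of a product of two normally convergent series. -/
lemma hasSum_integral_mul_of_summable {a b : ℝ} {f g : ℕ → ℝ → ℝ} {F G : ℝ → ℝ} {A B : ℕ → ℝ}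
    (hf : ∀ k, Continuous (f k)) (hg : ∀ k, Continuous (g k))
    (hfA : ∀ k, ∀ x ∈ Set.uIcc a b, |f k x| ≤ A k) (hgB : ∀ k, ∀ x ∈ Set.uIcc a b, |g k x| ≤ B k)
    (hA : Summable A) (hB : Summable B)
    (hF : ∀ x, HasSum (f · x) (F x)) (hG : ∀ x, HasSum (g · x) (G x)) :
    HasSum (fun p : ℕ × ℕ => ∫ x in a..b, f p.1 x * g p.2 x) (∫ x in a..b, F x * G x) := by
  have hA0 : ∀ k, 0 ≤ A k := fun k => (abs_nonneg _).trans (hfA k a Set.left_mem_uIcc)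
  have hB0 : ∀ k, 0 ≤ B k := fun k => (abs_nonneg _).trans (hgB k a Set.left_mem_uIcc)
  have hAB : Summable fun p : ℕ × ℕ => A p.1 * B p.2 := hA.mul_of_nonneg hB hA0 hB0
  have hle : ∀ p : ℕ × ℕ, ∀ x ∈ Set.uIcc a b, ‖f p.1 x * g p.2 x‖ ≤ A p.1 * B p.2 := by
    intro p x hx
    rw [norm_mul]
    exact mul_le_mul (hfA _ x hx) (hgB _ x hx) (norm_nonneg _) (hA0 _)
  refine intervalIntegral.hasSum_integral_of_dominated_convergence
    (fun p _ => A p.1 * B p.2) (fun p => by fun_prop)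
    (fun p => .of_forall fun x hx => hle p x (Set.uIoc_subset_uIcc hx))
    (.of_forall fun x _ => hAB) (by simp) (.of_forall fun x hx => ?_)
  refine (hF x).mul (hG x) ?_
  exact Summable.of_norm_bounded hAB fun p => hle p x (Set.uIoc_subset_uIcc hx)

lemma hasSum_sum_antidiagonal {f : ℕ × ℕ → ℝ} {S : ℝ} (h : HasSum f S) :
    HasSum (fun m => ∑ p ∈ Finset.HasAntidiagonal.antidiagonal m, f p) S := by
  have h' := (Finset.HasAntidiagonal.sigmaAntidiagonalEquivProd (A := ℕ)).hasSum_iff.2 h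
  refine h'.sigma fun m => ?_
  have := hasSum_fintype (fun c : Finset.HasAntidiagonal.antidiagonal m => f c)
  rwa [Finset.sum_coe_sort (Finset.HasAntidiagonal.antidiagonal m) f] at this

lemma abs_le_of_mem_uIcc_neg {R x : ℝ} (hx : x ∈ Set.uIcc (-R) R) : |x| ≤ |R| := by
  rcases le_total 0 R with h | h
  · rw [Set.uIcc_of_le (by linarith)] at hx
    exact (abs_le.2 hx).trans (le_abs_self R)
  · rw [Set.uIcc_of_ge (by linarith)] at hx
    rw [abs_of_nonpos h]
    exact abs_le.2 ⟨by linarith [hx.1], hx.2⟩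

/-- The shift `e` covers both `cosh` (`e = 0`) and `x * sinh` (`e = 1`). Domination holds because `0
≤ R² - x² ≤ R²` on the interval. -/
lemma hasSum_integral_besselSeries_mul (μ R : ℝ) (n e : ℕ) {g : ℕ → ℝ} {G : ℝ → ℝ}
    (hg : ∀ x, HasSum (fun j => g j * x ^ (2 * (j + e))) (G x)) :
    HasSum (fun p : ℕ × ℕ => (μ ^ 2 / 4) ^ p.1 / ((p.1)! * (p.1 + n)!) * g p.2 *
        (2 * 4 ^ p.1 * ((p.1)! * (2 * (p.2 + e))! * (p.2 + e + p.1)!) /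
          ((p.2 + e)! * (2 * (p.2 + e) + 2 * p.1 + 1)!) * R ^ (2 * p.1 + 2 * (p.2 + e) + 1)))
      (∫ x in (-R)..R, besselSeries n (μ ^ 2 * (R ^ 2 - x ^ 2) / 4) * G x) := by
  have h := hasSum_integral_mul_of_summable (a := -R) (b := R)
    (f := fun k x => (μ ^ 2 * (R ^ 2 - x ^ 2) / 4) ^ k / ((k ! : ℝ) * ((k + n)! : ℝ)))
    (g := fun j x => g j * x ^ (2 * (j + e)))
    (A := fun k => ‖(μ ^ 2 * R ^ 2 / 4) ^ k / ((k ! : ℝ) * ((k + n)! : ℝ))‖)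
    (B := fun j => ‖g j * |R| ^ (2 * (j + e))‖)
    (fun k => by fun_prop) (fun j => by fun_prop) ?_ ?_
    (summable_besselSeries_norm n _) (hg |R|).summable.norm
    (fun x => hasSum_besselSeries n _) hg
  · convert! h using 2 with p
    rw [← integral_sq_sub_sq_pow_mul_pow, ← intervalIntegral.integral_const_mul]
    refine intervalIntegral.integral_congr fun x _ => ?_
    simp only [mul_div_right_comm _ _ (4 : ℝ), mul_pow]
    ring
  · intro k x hx
    have hx' := sq_le_sq.2 (abs_le_of_mem_uIcc_neg hx)
    rw [Real.norm_eq_abs, abs_div, abs_div, abs_pow, abs_pow]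
    refine div_le_div_of_nonneg_right (pow_le_pow_left₀ (abs_nonneg _) ?_ k) (abs_nonneg _)
    rw [abs_of_nonneg (by have := sub_nonneg.2 hx'; positivity), abs_of_nonneg (by positivity)]
    gcongr
    exact sub_le_self _ (sq_nonneg x)
  · intro j x hx
    rw [Real.norm_eq_abs, abs_mul, abs_mul, abs_pow, abs_pow, abs_abs]
    exact mul_le_mul_of_nonneg_left
      (pow_le_pow_left₀ (abs_nonneg _) (abs_le_of_mem_uIcc_neg hx) _) (abs_nonneg _)

lemma add_pow_eq_sum_antidiagonal_div (x y : ℝ) (m : ℕ) :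
    (x + y) ^ m = ∑ p ∈ Finset.HasAntidiagonal.antidiagonal m,
      m ! / (p.1! * p.2!) * (x ^ p.1 * y ^ p.2) := by
  rw [(Commute.all x y).add_pow']
  refine Finset.sum_congr rfl fun p hp => ?_
  rw [Finset.HasAntidiagonal.mem_antidiagonal] at hp
  rw [nsmul_eq_mul, ← hp, Nat.cast_add_choose]

/-- The factorial `(k + 1)!` in the series of `I_1` shifts the binomial index by one, so the term
free of `x` is absent. -/
lemma add_pow_succ_sub_eq_sum_antidiagonal_div (x y : ℝ) (m : ℕ) :
    (x + y) ^ (m + 1) - y ^ (m + 1) = ∑ p ∈ Finset.HasAntidiagonal.antidiagonal m,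
      (m + 1)! / ((p.1 + 1)! * p.2!) * (x ^ (p.1 + 1) * y ^ p.2) := by
  rw [add_pow_eq_sum_antidiagonal_div, Finset.Nat.sum_antidiagonal_succ]
  have : ((m + 1)! : ℝ) ≠ 0 := by positivity
  simp [this]

/-- The factorials of the two series cancel against the beta integral, leaving binomial coefficients
on each antidiagonal. -/
lemma hasSum_integral_besselSeries_zero_mul_cosh (μ θ R : ℝ) :
    HasSum (fun m : ℕ => R ^ (2 * m + 1) / (2 * m + 1)! * (μ ^ 2 + θ ^ 2) ^ m)
      (1 / 2 * ∫ x in (-R)..R, besselSeries 0 (μ ^ 2 * (R ^ 2 - x ^ 2) / 4) * Real.cosh (θ * x)) := by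
  have hg : ∀ x, HasSum (fun j : ℕ => θ ^ (2 * j) / (2 * j)! * x ^ (2 * (j + 0)))
      (Real.cosh (θ * x)) := by
    intro x
    convert! Real.hasSum_cosh (θ * x) using 2 with j
    rw [mul_pow, add_zero]
    ring
  convert! hasSum_sum_antidiagonal
    ((hasSum_integral_besselSeries_mul μ R 0 0 hg).mul_left (1 / 2)) using 2 with m
  rw [add_pow_eq_sum_antidiagonal_div, Finset.mul_sum]
  refine Finset.sum_congr rfl fun p hp => ?_
  rw [Finset.HasAntidiagonal.mem_antidiagonal] at hp
  obtain ⟨k, j⟩ := p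
  obtain rfl : m = k + j := hp.symm
  simp only [add_zero, show 2 * j + 2 * k + 1 = 2 * (k + j) + 1 by ring,
    show 2 * k + 2 * j + 1 = 2 * (k + j) + 1 by ring, add_comm j k, div_pow, ← pow_mul]
  field_simp

lemma hasSum_integral_besselSeries_one_mul_cosh (μ θ R : ℝ) :
    HasSum (fun m : ℕ => R ^ (2 * (m + 1)) / (2 * (m + 1))! *
        ((μ ^ 2 + θ ^ 2) ^ (m + 1) - (θ ^ 2) ^ (m + 1)))
      (μ ^ 2 / 4 * R * ∫ x in (-R)..R,
        besselSeries 1 (μ ^ 2 * (R ^ 2 - x ^ 2) / 4) * Real.cosh (θ * x)) := by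
  have hg : ∀ x, HasSum (fun j : ℕ => θ ^ (2 * j) / (2 * j)! * x ^ (2 * (j + 0)))
      (Real.cosh (θ * x)) := by
    intro x
    convert! Real.hasSum_cosh (θ * x) using 2 with j
    rw [mul_pow, add_zero]
    ring
  convert! hasSum_sum_antidiagonal
    ((hasSum_integral_besselSeries_mul μ R 1 0 hg).mul_left (μ ^ 2 / 4 * R)) using 2 with m
  rw [add_pow_succ_sub_eq_sum_antidiagonal_div, Finset.mul_sum]
  refine Finset.sum_congr rfl fun p hp => ?_
  rw [Finset.HasAntidiagonal.mem_antidiagonal] at hp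
  obtain ⟨k, j⟩ := p
  obtain rfl : m = k + j := hp.symm
  have e1 : ((2 * (k + j + 1))! : ℝ) = (2 * (k + j + 1)) * (2 * (k + j) + 1)! := by
    rw [show 2 * (k + j + 1) = 2 * (k + j) + 1 + 1 by ring, Nat.factorial_succ]
    push_cast; ring
  have e2 : ((k + j + 1)! : ℝ) = (k + j + 1) * (k + j)! := by
    rw [Nat.factorial_succ]; push_cast; ring
  simp only [add_zero, show 2 * j + 2 * k + 1 = 2 * (k + j) + 1 by ring,
    show 2 * k + 2 * j + 1 = 2 * (k + j) + 1 by ring, add_comm j k, div_pow, ← pow_mul]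
  rw [e1, e2]
  have h3 : (k + j + 1 : ℝ) ≠ 0 := by positivity
  field_simp
  ring

lemma hasSum_integral_besselSeries_one_mul_sinh (μ θ R : ℝ) :
    HasSum (fun m : ℕ => R ^ (2 * (m + 1) + 1) / (2 * (m + 1) + 1)! *
        (θ * ((μ ^ 2 + θ ^ 2) ^ (m + 1) - (θ ^ 2) ^ (m + 1))))
      (μ ^ 2 / 4 * ∫ x in (-R)..R,
        besselSeries 1 (μ ^ 2 * (R ^ 2 - x ^ 2) / 4) * (x * Real.sinh (θ * x))) := by
  have hg : ∀ x, HasSum (fun j : ℕ => θ ^ (2 * j + 1) / (2 * j + 1)! * x ^ (2 * (j + 1)))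
      (x * Real.sinh (θ * x)) := by
    intro x
    convert! (Real.hasSum_sinh (θ * x)).mul_left x using 2 with j
    rw [mul_pow]
    ring
  convert! hasSum_sum_antidiagonal
    ((hasSum_integral_besselSeries_mul μ R 1 1 hg).mul_left (μ ^ 2 / 4)) using 2 with m
  rw [add_pow_succ_sub_eq_sum_antidiagonal_div, Finset.mul_sum, Finset.mul_sum]
  refine Finset.sum_congr rfl fun p hp => ?_
  rw [Finset.HasAntidiagonal.mem_antidiagonal] at hp
  obtain ⟨k, j⟩ := p
  obtain rfl : m = k + j := hp.symm
  have e1 : ((2 * (j + 1))! : ℝ) = (2 * (j + 1)) * (2 * j + 1)! := by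
    rw [show 2 * (j + 1) = 2 * j + 1 + 1 by ring, Nat.factorial_succ]
    push_cast; ring
  have e2 : ((j + 1)! : ℝ) = (j + 1) * j ! := by
    rw [Nat.factorial_succ]; push_cast; ring
  simp only [show 2 * (j + 1) + 2 * k + 1 = 2 * (k + j + 1) + 1 by ring,
    show 2 * k + 2 * (j + 1) + 1 = 2 * (k + j + 1) + 1 by ring,
    show j + 1 + k = k + j + 1 by ring, div_pow, ← pow_mul]
  rw [e1, e2]
  have h3 : (j + 1 : ℝ) ≠ 0 := by positivity
  field_simp
  ring

lemma integral_besselSeries_zero_mul_cosh {μ θ R q : ℝ} (hq : q ≠ 0)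
    (hq2 : q ^ 2 = μ ^ 2 + θ ^ 2) :
    1 / 2 * ∫ x in (-R)..R, besselSeries 0 (μ ^ 2 * (R ^ 2 - x ^ 2) / 4) * Real.cosh (θ * x) =
      Real.sinh (q * R) / q := by
  refine (hasSum_integral_besselSeries_zero_mul_cosh μ θ R).unique ?_
  convert! (Real.hasSum_sinh (q * R)).div_const q using 2 with m
  rw [← hq2]
  field_simp
  ring

lemma integral_besselSeries_one_mul_cosh {μ θ R q : ℝ} (hq2 : q ^ 2 = μ ^ 2 + θ ^ 2) :
    μ ^ 2 / 4 * R * ∫ x in (-R)..R,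
      besselSeries 1 (μ ^ 2 * (R ^ 2 - x ^ 2) / 4) * Real.cosh (θ * x) =
      Real.cosh (q * R) - Real.cosh (θ * R) := by
  refine (hasSum_integral_besselSeries_one_mul_cosh μ θ R).unique ?_
  -- The difference of the two `cosh` series has zero constant term, so it may start at index one.
  have h := (hasSum_nat_add_iff' 1).2 ((Real.hasSum_cosh (q * R)).sub (Real.hasSum_cosh (θ * R)))
  simp only [Finset.range_one, Finset.sum_singleton, mul_zero, pow_zero, sub_self, sub_zero] at h
  convert! h using 2 with m
  rw [← hq2]
  ring

lemma integral_besselSeries_one_mul_sinh {μ θ R q : ℝ} (hq : q ≠ 0)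
    (hq2 : q ^ 2 = μ ^ 2 + θ ^ 2) :
    μ ^ 2 / 4 * ∫ x in (-R)..R,
      besselSeries 1 (μ ^ 2 * (R ^ 2 - x ^ 2) / 4) * (x * Real.sinh (θ * x)) =
      θ * Real.sinh (q * R) / q - Real.sinh (θ * R) := by
  refine (hasSum_integral_besselSeries_one_mul_sinh μ θ R).unique ?_
  have h := (hasSum_nat_add_iff' 1).2
    (((Real.hasSum_sinh (q * R)).mul_left (θ / q)).sub (Real.hasSum_sinh (θ * R)))
  simp only [Finset.range_one, Finset.sum_singleton, mul_zero, zero_add, pow_one,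
    Nat.factorial_one, Nat.cast_one, div_one] at h
  rw [show θ / q * (q * R) - θ * R = 0 by field_simp; ring, sub_zero] at h
  convert! h using 2 with m
  · rw [← hq2]
    field_simp
    ring
  · ring

/-! ### Moment generating functions of boundedly supported measures. -/

/-- Bounded support makes every exponential moment finite, so analytic continuation carries the
equality from the real line to all complex arguments. -/
lemma MeasureTheory.Measure.ext_of_mgf_of_ae_abs_le {ν ν' : Measure ℝ} [IsFiniteMeasure ν]
    [IsFiniteMeasure ν'] {R : ℝ} (hν : ∀ᵐ x ∂ν, |x| ≤ R)
    (h : mgf id ν = mgf id ν') : ν = ν' := by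
  have hint : integrableExpSet id ν = Set.univ := by
    refine Set.eq_univ_of_forall fun t => ?_
    exact integrable_exp_mul_of_mem_Icc aemeasurable_id (hν.mono fun x hx => abs_le.1 hx)
  have h0 : ν = 0 ↔ ν' = 0 := by
    have := congrFun h 0
    simp only [mgf_zero'] at this
    rw [← Measure.measure_univ_eq_zero, ← Measure.measure_univ_eq_zero, ← measureReal_eq_zero_iff, ← measureReal_eq_zero_iff, this]
  refine Measure.ext_of_complexMGF_id_eq (funext fun z => eqOn_complexMGF_of_mgf' h h0 ?_)
  simp [hint]

lemma intervalIntegral_eq_zero_of_odd {f : ℝ → ℝ} (hf : ∀ x, f (-x) = -f x) (R : ℝ) :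
    ∫ x in (-R)..R, f x = 0 := by
  have h := intervalIntegral.integral_comp_neg (a := -R) (b := R) f
  simp only [hf, neg_neg, intervalIntegral.integral_neg] at h
  linarith

/-- Write `exp = cosh + sinh`; the two odd products integrate to zero. -/
lemma intervalIntegral_mul_exp_of_even {g : ℝ → ℝ} (hg : Continuous g) (he : ∀ x, g (-x) = g x)
    (A s θ R : ℝ) :
    ∫ x in (-R)..R, (A + s * x) * g x * Real.exp (θ * x) =
      A * (∫ x in (-R)..R, g x * Real.cosh (θ * x)) +
        s * ∫ x in (-R)..R, g x * (x * Real.sinh (θ * x)) := by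
  have h1 : ∫ x in (-R)..R, (A * (g x * Real.sinh (θ * x)) + s * (g x * (x * Real.cosh (θ * x))))
      = 0 := by
    refine intervalIntegral_eq_zero_of_odd (fun x => ?_) R
    simp only [he, mul_neg, Real.sinh_neg, Real.cosh_neg]
    ring
  rw [← intervalIntegral.integral_const_mul, ← intervalIntegral.integral_const_mul,
    ← intervalIntegral.integral_add (Continuous.intervalIntegrable (by fun_prop) _ _)
      (Continuous.intervalIntegrable (by fun_prop) _ _), ← add_zero (∫ x in _.._, _ + _), ← h1,
    ← intervalIntegral.integral_add (Continuous.intervalIntegrable (by fun_prop) _ _)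
      (Continuous.intervalIntegrable (by fun_prop) _ _)]
  refine intervalIntegral.integral_congr fun x _ => ?_
  rw [← Real.cosh_add_sinh]
  ring

lemma withDensity_indicator_abs_lt {g h : ℝ → ℝ} {R : ℝ} (hgh : ∀ x, |x| < R → h x = g x) :
    volume.withDensity ({x : ℝ | |x| < R}.indicator fun x => ENNReal.ofReal (h x)) =
      (volume.restrict (Set.Ioo (-R) R)).withDensity fun x => ENNReal.ofReal (g x) := by
  have hs : {x : ℝ | |x| < R} = Set.Ioo (-R) R := by
    ext x; simp [abs_lt]
  rw [← withDensity_indicator measurableSet_Ioo, hs]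
  congr 1
  refine Set.indicator_congr fun x hx => ?_
  rw [hgh x (abs_lt.2 hx)]

lemma mgf_withDensity_restrict_Ioo {g : ℝ → ℝ} (hg : Continuous g) {R : ℝ} (hR : 0 ≤ R)
    (h0 : ∀ x ∈ Set.Ioo (-R) R, 0 ≤ g x) (θ : ℝ) :
    mgf id ((volume.restrict (Set.Ioo (-R) R)).withDensity fun x => ENNReal.ofReal (g x)) θ =
      ∫ x in (-R)..R, g x * Real.exp (θ * x) := by
  rw [mgf, integral_withDensity_eq_integral_toReal_smul (by fun_prop)
    (.of_forall fun _ => ENNReal.ofReal_lt_top), intervalIntegral.integral_of_le (by linarith),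
    integral_Ioc_eq_integral_Ioo]
  refine setIntegral_congr_fun measurableSet_Ioo fun x hx => ?_
  simp [ENNReal.toReal_ofReal (h0 x hx)]

lemma isFiniteMeasure_withDensity_restrict_Ioo {g : ℝ → ℝ} (hg : Continuous g) (R : ℝ) :
    IsFiniteMeasure
      ((volume.restrict (Set.Ioo (-R) R)).withDensity fun x => ENNReal.ofReal (g x)) :=
  isFiniteMeasure_withDensity_ofReal
    ((hg.integrableOn_Icc (a := -R) (b := R)).mono_set Set.Ioo_subset_Icc_self).2

lemma ae_abs_le_withDensity_restrict_Ioo (f : ℝ → ℝ≥0∞) (R : ℝ) :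
    ∀ᵐ x ∂(volume.restrict (Set.Ioo (-R) R)).withDensity f, |x| ≤ R :=
  withDensity_absolutelyContinuous _ _ <|
    (ae_restrict_mem measurableSet_Ioo).mono fun _ hx => (abs_lt.2 hx).le

lemma mgf_id_smul_dirac_add (a : ℝ≥0∞) (x₀ θ R : ℝ) {ν : Measure ℝ} [IsFiniteMeasure ν]
    (hν : ∀ᵐ x ∂ν, |x| ≤ R) :
    mgf id (a • (Measure.dirac x₀ + ν)) θ = a.toReal * (Real.exp (θ * x₀) + mgf id ν θ) := by
  rw [mgf, integral_smul_measure, integral_add_measure, integral_dirac, mgf]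
  · simp
  · exact integrable_dirac (by simp)
  · exact integrable_exp_mul_of_mem_Icc aemeasurable_id (hν.mono fun x hx => abs_le.1 hx)

/-! ### Transforms of the two velocity densities. -/

section telegraph

variable {μ R : ℝ}

lemma besselI_zero_mul_sqrt {x : ℝ} (hx : |x| < R) :
    besselI 0 (μ * √(R ^ 2 - x ^ 2)) = besselSeries 0 (μ ^ 2 * (R ^ 2 - x ^ 2) / 4) := by
  have : 0 ≤ R ^ 2 - x ^ 2 := by
    rw [← sq_abs x]; nlinarith [abs_nonneg x]
  rw [besselI_eq, mul_pow, Real.sq_sqrt this, pow_zero, one_mul]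

/-- The denominator cancels the single odd factor of `I_1`; strictness of `|x| < R` keeps it
nonzero. -/
lemma besselI_one_mul_sqrt_div {x : ℝ} (hx : |x| < R) :
    besselI 1 (μ * √(R ^ 2 - x ^ 2)) / √(R ^ 2 - x ^ 2) =
      μ / 2 * besselSeries 1 (μ ^ 2 * (R ^ 2 - x ^ 2) / 4) := by
  have h : 0 < R ^ 2 - x ^ 2 := by
    rw [← sq_abs x]; nlinarith [abs_nonneg x]
  have h' := Real.sqrt_pos.2 h
  rw [besselI_eq, mul_pow, Real.sq_sqrt h.le, pow_one]
  field_simp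

lemma besselSeries_sq_sub_sq_nonneg (n : ℕ) {x : ℝ} (hx : x ∈ Set.Ioo (-R) R) :
    0 ≤ besselSeries n (μ ^ 2 * (R ^ 2 - x ^ 2) / 4) := by
  have h : 0 ≤ R ^ 2 - x ^ 2 := by nlinarith [hx.1, hx.2]
  exact besselSeries_nonneg n (by positivity)

/-- The density of the telegraph position on the event that the velocity equals the initial one,
up to the factor `exp (-λ t)`; here `μ = λ / c`, `R = c t` and `s` is the sign of the velocity. -/
noncomputable def sameVelocityDensity (μ R s x : ℝ) : ℝ :=
  μ / 2 * (R + x * s) * (μ / 2 * besselSeries 1 (μ ^ 2 * (R ^ 2 - x ^ 2) / 4))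

/-- The density of the telegraph position on the event that the velocity is opposite to the initial
one, up to the factor `exp (-λ t)`; here `μ = λ / c` and `R = c t`. -/
noncomputable def oppositeVelocityDensity (μ R x : ℝ) : ℝ :=
  μ / 2 * besselSeries 0 (μ ^ 2 * (R ^ 2 - x ^ 2) / 4)

lemma continuous_sameVelocityDensity (μ R s : ℝ) : Continuous (sameVelocityDensity μ R s) := by
  have := continuous_besselSeries 1
  unfold sameVelocityDensity
  fun_prop

lemma continuous_oppositeVelocityDensity (μ R : ℝ) : Continuous (oppositeVelocityDensity μ R) := by
  have := continuous_besselSeries 0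
  unfold oppositeVelocityDensity
  fun_prop

lemma mgf_oppositeVelocityDensity (hμ : 0 < μ) (hR : 0 ≤ R) {θ q : ℝ} (hq : q ≠ 0)
    (hq2 : q ^ 2 = μ ^ 2 + θ ^ 2) :
    mgf id ((volume.restrict (Set.Ioo (-R) R)).withDensity fun x =>
      ENNReal.ofReal (oppositeVelocityDensity μ R x)) θ = μ * (Real.sinh (q * R) / q) := by
  rw [mgf_withDensity_restrict_Ioo (continuous_oppositeVelocityDensity μ R) hR
    fun x hx => mul_nonneg (by positivity) (besselSeries_sq_sub_sq_nonneg 0 hx),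
    ← integral_besselSeries_zero_mul_cosh hq hq2]
  have hc := continuous_besselSeries 0
  have := intervalIntegral_mul_exp_of_even
    (g := fun x => besselSeries 0 (μ ^ 2 * (R ^ 2 - x ^ 2) / 4)) (by fun_prop) (by simp)
    (μ / 2) 0 θ R
  simp only [zero_mul, add_zero] at this
  simp only [oppositeVelocityDensity, this]
  ring

lemma mgf_sameVelocityDensity (hR : 0 ≤ R) {s : ℝ} (hs : s = -1 ∨ s = 1)
    {θ q : ℝ} (hq : q ≠ 0) (hq2 : q ^ 2 = μ ^ 2 + θ ^ 2) :
    mgf id ((volume.restrict (Set.Ioo (-R) R)).withDensity fun x =>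
      ENNReal.ofReal (sameVelocityDensity μ R s x)) θ =
      Real.cosh (q * R) + θ * s * (Real.sinh (q * R) / q) - Real.exp (θ * (s * R)) := by
  rw [mgf_withDensity_restrict_Ioo (continuous_sameVelocityDensity μ R s) hR]
  · have hc := continuous_besselSeries 1
    have := intervalIntegral_mul_exp_of_even
      (g := fun x => besselSeries 1 (μ ^ 2 * (R ^ 2 - x ^ 2) / 4)) (by fun_prop) (by simp)
      (μ ^ 2 / 4 * R) (μ ^ 2 / 4 * s) θ R
    rw [integral_besselSeries_one_mul_cosh hq2, mul_comm _ s, mul_assoc s,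
      integral_besselSeries_one_mul_sinh hq hq2] at this
    have he : Real.exp (θ * (s * R)) = Real.cosh (θ * R) + s * Real.sinh (θ * R) := by
      rw [← Real.cosh_add_sinh]
      rcases hs with rfl | rfl <;> simp
    rw [he]
    convert! this using 1
    · refine intervalIntegral.integral_congr fun x _ => ?_
      simp only [sameVelocityDensity]
      ring
    · ring
  · intro x hx
    have h1 : 0 ≤ R + x * s := by
      rcases hs with rfl | rfl <;> linarith [hx.1, hx.2]
    rw [sameVelocityDensity, show ∀ a b c : ℝ, a * b * (a * c) = a ^ 2 * b * c by intros; ring]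
    exact mul_nonneg (by positivity) (besselSeries_sq_sub_sq_nonneg 1 hx)

end telegraph

/-! ### Measurability for right-continuous processes. -/

section

open Filter Topology Set

/-- A process with right-continuous paths is progressively measurable. -/
lemma measurable_uncurry_min_of_rightCont {Ω : Type*} {mΩ : MeasurableSpace Ω} {f : ℝ → Ω → ℝ}
    {T : ℝ} (hm : ∀ s ≤ T, Measurable (f s))
    (hc : ∀ ω s, ContinuousWithinAt (fun u => f u ω) (Ici s) s) :
    Measurable fun p : ℝ × Ω => f (min p.1 T) p.2 := by
  -- Time is rounded to the next point of the grid of mesh `1 / (n + 1)`, strictly to the right,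
  -- then clipped at `T` so that only values up to time `T` are used.
  refine measurable_of_tendsto_metrizable
    (f := fun (n : ℕ) (p : ℝ × Ω) => f (min ((⌊(n + 1) * p.1⌋ + 1) / (n + 1)) T) p.2)
    (fun n => ?_) ?_
  · have h1 : Measurable fun p : ℤ × Ω => f (min ((p.1 + 1) / (n + 1)) T) p.2 :=
      measurable_from_prod_countable_right fun k =>
        hm (min ((k + 1) / (n + 1)) T) (min_le_right _ _)
    have h2 : Measurable fun p : ℝ × Ω => (⌊(n + 1) * p.1⌋, p.2) :=
      (Int.measurable_floor.comp (measurable_const.mul measurable_fst)).prodMk measurable_snd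
    exact h1.comp h2
  · rw [tendsto_pi_nhds]
    rintro ⟨s, ω⟩
    have hge : ∀ n : ℕ, s ≤ (⌊(n + 1) * s⌋ + 1) / (n + 1) := fun n => by
      rw [le_div_iff₀ (by positivity)]
      linarith [Int.lt_floor_add_one ((n + 1) * s)]
    have hle : ∀ n : ℕ, ((⌊(n + 1) * s⌋ : ℝ) + 1) / (n + 1) ≤ s + 1 / ((n : ℝ) + 1) := fun n => by
      rw [div_le_iff₀ (by positivity), add_mul s, one_div_mul_cancel (by positivity)]
      linarith [Int.floor_le ((n + 1) * s)]
    have ht : Tendsto (fun n : ℕ => ((⌊(n + 1) * s⌋ : ℝ) + 1) / (n + 1)) atTop (𝓝 s) := by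
      refine tendsto_of_tendsto_of_tendsto_of_le_of_le tendsto_const_nhds ?_ hge hle
      simpa using tendsto_const_nhds.add (tendsto_one_div_add_atTop_nhds_zero_nat (𝕜 := ℝ))
    refine (hc ω (min s T)).tendsto.comp (tendsto_nhdsWithin_iff.2 ⟨?_, ?_⟩)
    · exact ht.min tendsto_const_nhds
    · exact .of_forall fun n => min_le_min_right T (hge n)

lemma measurable_intervalIntegral_of_rightCont {Ω : Type*} {mΩ : MeasurableSpace Ω}
    {f : ℝ → Ω → ℝ} {T : ℝ} (hT : 0 ≤ T) (hm : ∀ s ≤ T, Measurable (f s))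
    (hc : ∀ ω s, ContinuousWithinAt (fun u => f u ω) (Ici s) s) :
    Measurable fun ω => ∫ s in 0..T, f s ω := by
  have h : Measurable fun ω => ∫ s in Ioc 0 T, f (min s T) ω :=
    ((measurable_uncurry_min_of_rightCont hm hc).stronglyMeasurable.integral_prod_left'
      (μ := volume.restrict (Ioc 0 T))).measurable
  convert! h using 2 with ω
  rw [intervalIntegral.integral_of_le hT]
  exact setIntegral_congr_fun measurableSet_Ioc fun s hs => by rw [min_eq_left hs.2]

lemma integrable_uncurry_of_rightCont {Ω : Type*} {mΩ : MeasurableSpace Ω} {P : Measure Ω}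
    [IsFiniteMeasure P] {f : ℝ → Ω → ℝ} {T C : ℝ} (hT : 0 ≤ T)
    (hm : ∀ s ≤ T, Measurable (f s))
    (hc : ∀ ω s, ContinuousWithinAt (fun u => f u ω) (Ici s) s)
    (hC : ∀ s ∈ Ioc 0 T, ∀ ω, |f s ω| ≤ C) :
    Integrable (Function.uncurry f) ((volume.restrict (uIoc 0 T)).prod P) := by
  have h : Integrable (fun p : ℝ × Ω => f (min p.1 T) p.2)
      ((volume.restrict (Ioc 0 T)).prod P) := by
    refine Integrable.of_bound
      (measurable_uncurry_min_of_rightCont hm hc).aestronglyMeasurable C ?_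
    have h1 : ∀ᵐ p ∂(volume.restrict (Ioc 0 T)).prod P, p.1 ∈ Ioc 0 T :=
      Measure.quasiMeasurePreserving_fst.ae (ae_restrict_mem measurableSet_Ioc)
    filter_upwards [h1] with p hp
    rw [min_eq_left hp.2]
    exact hC _ hp _
  rw [uIoc_of_le hT]
  refine h.congr ?_
  have h1 : ∀ᵐ p ∂(volume.restrict (Ioc 0 T)).prod P, p.1 ∈ Ioc 0 T :=
    Measure.quasiMeasurePreserving_fst.ae (ae_restrict_mem measurableSet_Ioc)
  filter_upwards [h1] with p hp
  rw [min_eq_left hp.2]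
  rfl

/-! ### Paths of the unit-speed process. -/

section paths

variable {Ω : Type*} {N : ℝ≥0 → Ω → ℕ}

/-- The velocity sign `(-1) ^ N(s)`, indexed by real times. -/
def paritySign (N : ℝ≥0 → Ω → ℕ) (s : ℝ) (ω : Ω) : ℝ := (-1) ^ N s.toNNReal ω

/-- The position of the telegraph process started at `0` with unit velocity. -/
noncomputable def unitPosition (N : ℝ≥0 → Ω → ℕ) (t : ℝ) (ω : Ω) : ℝ :=
  ∫ s in 0..t, paritySign N s ω

lemma abs_paritySign (N : ℝ≥0 → Ω → ℕ) (s : ℝ) (ω : Ω) : |paritySign N s ω| = 1 := by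
  simp [paritySign, abs_pow]

lemma paritySign_rightCont (hrc : ∀ ω t, ContinuousWithinAt (fun s => N s ω) (Ici t) t) (ω : Ω)
    (s : ℝ) : ContinuousWithinAt (fun u => paritySign N u ω) (Ici s) s := by
  have h1 : ContinuousWithinAt (fun u : ℝ => N u.toNNReal ω) (Ici s) s :=
    (hrc ω s.toNNReal).comp continuous_real_toNNReal.continuousWithinAt
      fun u hu => Real.toNNReal_le_toNNReal hu
  exact (continuous_of_discreteTopology (f := fun n : ℕ => (-1 : ℝ) ^ n)).continuousAt
    |>.comp_continuousWithinAt h1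

lemma measurable_paritySign {mΩ : MeasurableSpace Ω} {s : ℝ} (h : Measurable (N s.toNNReal)) :
    Measurable (paritySign N s) :=
  (measurable_from_top (f := fun n : ℕ => (-1 : ℝ) ^ n)).comp h

/-- Measurability is required only up to time `t`, so the lemma also applies with the sigma-algebra
of the past in place of the ambient one. -/
lemma measurable_unitPosition {mΩ : MeasurableSpace Ω} {t : ℝ} (ht : 0 ≤ t)
    (hm : ∀ s ≤ t.toNNReal, Measurable (N s))
    (hrc : ∀ ω t, ContinuousWithinAt (fun s => N s ω) (Ici t) t) :
    Measurable (unitPosition N t) :=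
  measurable_intervalIntegral_of_rightCont ht
    (fun _ hs => measurable_paritySign (hm _ (Real.toNNReal_le_toNNReal hs)))
    (paritySign_rightCont hrc)

lemma measurable_paritySign_path (hrc : ∀ ω t, ContinuousWithinAt (fun s => N s ω) (Ici t) t)
    (ω : Ω) : Measurable fun s => paritySign N s ω := by
  have : ∀ T : ℕ, Measurable fun s : ℝ => paritySign N (min s T) ω := fun T => by
    -- With the discrete sigma-algebra on `Ω`, joint measurability costs nothing and restricts to a
    -- single path.
    let _ : MeasurableSpace Ω := ⊤
    exact (measurable_uncurry_min_of_rightCont (T := T)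
      (fun s _ => measurable_from_top) (paritySign_rightCont hrc)).comp
      (measurable_id.prodMk measurable_const)
  refine measurable_of_tendsto_metrizable this (tendsto_pi_nhds.2 fun s => ?_)
  refine tendsto_const_nhds.congr' ?_
  filter_upwards [eventually_ge_atTop ⌈s⌉₊] with T hT
  rw [min_eq_left (Nat.ceil_le.1 hT)]

lemma intervalIntegrable_paritySign
    (hrc : ∀ ω t, ContinuousWithinAt (fun s => N s ω) (Ici t) t) (ω : Ω) (a b : ℝ) :
    IntervalIntegrable (fun s => paritySign N s ω) volume a b := by
  refine (intervalIntegrable_const (c := (1 : ℝ))).mono_fun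
    (measurable_paritySign_path hrc ω).aestronglyMeasurable (.of_forall fun s => ?_)
  simp [abs_paritySign]

lemma continuous_unitPosition (hrc : ∀ ω t, ContinuousWithinAt (fun s => N s ω) (Ici t) t)
    (ω : Ω) : Continuous fun t => unitPosition N t ω :=
  intervalIntegral.continuous_primitive (intervalIntegrable_paritySign hrc ω) 0

lemma abs_unitPosition_le {t : ℝ} (ht : 0 ≤ t) (ω : Ω) : |unitPosition N t ω| ≤ t := by
  have := intervalIntegral.norm_integral_le_of_norm_le_const (a := 0) (b := t) (C := 1)
    (f := fun s => paritySign N s ω) fun s _ => (abs_paritySign N s ω).le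
  simpa [unitPosition, abs_of_nonneg ht] using this

/-- Right continuity of the sign gives the position a right derivative everywhere, enough for the
fundamental theorem of calculus despite the velocity jumps. -/
lemma exp_unitPosition_eq (hrc : ∀ ω t, ContinuousWithinAt (fun s => N s ω) (Ici t) t)
    (θ : ℝ) (ω : Ω) (t : ℝ) :
    Real.exp (θ * unitPosition N t ω) =
      1 + θ * ∫ s in 0..t, paritySign N s ω * Real.exp (θ * unitPosition N s ω) := by
  have hcont : Continuous fun t => Real.exp (θ * unitPosition N t ω) := by
    have := continuous_unitPosition hrc ω
    fun_prop
  have hint : IntervalIntegrable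
      (fun s => Real.exp (θ * unitPosition N s ω) * (θ * paritySign N s ω)) volume 0 t :=
    ((intervalIntegrable_paritySign hrc ω 0 t).const_mul θ).continuousOn_mul hcont.continuousOn
  have h := intervalIntegral.integral_eq_sub_of_hasDeriv_right hcont.continuousOn
    (fun x _ => ?_) hint
  · rw [← intervalIntegral.integral_const_mul]
    have h0 : unitPosition N 0 ω = 0 := by simp [unitPosition]
    rw [h0, mul_zero, Real.exp_zero] at h
    rw [eq_add_of_sub_eq' h.symm]
    congr 1
    exact intervalIntegral.integral_congr fun s _ => by ring
  · refine HasDerivWithinAt.exp (HasDerivWithinAt.const_mul θ ?_)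
    exact (intervalIntegral.integral_hasDerivWithinAt_right (s := Ici x) (t := Ioi x)
      (intervalIntegrable_paritySign hrc ω 0 x)
      ((measurable_paritySign_path hrc ω).stronglyMeasurable.stronglyMeasurableAtFilter)
      ((paritySign_rightCont hrc ω x).mono Ioi_subset_Ici_self)).Ioi_of_Ici

end paths

/-! ### The ordinary differential equation for the moments. -/

/-- The linear system governing the exponential moments of the telegraph process. -/
lemma eq_of_telegraph_integral_equations {a b : ℝ → ℝ} {θ l r : ℝ} (hr : r ≠ 0)
    (hr2 : r ^ 2 = l ^ 2 + θ ^ 2)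
    (hbi : ∀ t, 0 ≤ t → IntervalIntegrable b volume 0 t)
    (ha : ∀ t, 0 ≤ t → a t = 1 + θ * ∫ s in 0..t, b s)
    (hb : ∀ t, 0 ≤ t → b t = Real.exp (-(2 * l * t)) *
      (1 + θ * ∫ s in 0..t, Real.exp (2 * l * s) * a s)) {t : ℝ} (ht : 0 ≤ t) :
    a t = Real.exp (-(l * t)) * (Real.cosh (r * t) + (θ + l) * (Real.sinh (r * t) / r)) ∧
    b t = Real.exp (-(l * t)) * (Real.cosh (r * t) + (θ - l) * (Real.sinh (r * t) / r)) := by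
  have hprim : ∀ f : ℝ → ℝ, (∀ t, 0 ≤ t → IntervalIntegrable f volume 0 t) →
      ContinuousOn (fun t => ∫ s in 0..t, f s) (Ici 0) := by
    intro f hf x hx
    have h1 := intervalIntegral.continuousOn_primitive_interval'
      (hf (x + 1) (by have : (0:ℝ) ≤ x := hx; linarith)) left_mem_uIcc
    rw [uIcc_of_le (by have : (0:ℝ) ≤ x := hx; linarith)] at h1
    refine (h1 x ⟨hx, by linarith⟩).mono_of_mem_nhdsWithin ?_
    rw [← Ici_inter_Iic]
    exact inter_mem self_mem_nhdsWithin (mem_nhdsWithin_of_mem_nhds (Iic_mem_nhds (by linarith)))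
  -- Bootstrap: integrability of `b` makes `a` continuous, which in turn makes `b` continuous and
  -- both right differentiable.
  have hac : ContinuousOn a (Ici 0) :=
    ((hprim b hbi).const_mul θ |>.const_add 1).congr fun t ht => ha t ht
  have hec : ContinuousOn (fun s => Real.exp (2 * l * s) * a s) (Ici 0) :=
    ContinuousOn.mul (by fun_prop) hac
  have hii : ∀ f : ℝ → ℝ, ContinuousOn f (Ici 0) → ∀ t, 0 ≤ t →
      IntervalIntegrable f volume 0 t := fun f hf t ht =>
    (hf.mono (by rw [uIcc_of_le ht]; exact Icc_subset_Ici_self)).intervalIntegrable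
  have hbc : ContinuousOn b (Ici 0) := by
    refine ContinuousOn.congr ?_ fun t ht => hb t ht
    exact ContinuousOn.mul (by fun_prop) ((hprim _ (hii _ hec)).const_mul θ |>.const_add 1)
  have hderiv : ∀ f : ℝ → ℝ, ContinuousOn f (Ici 0) → ∀ t, 0 ≤ t →
      HasDerivWithinAt (fun t => ∫ s in 0..t, f s) (f t) (Ici t) t := fun f hf t ht =>
    intervalIntegral.integral_hasDerivWithinAt_right (hii f hf t ht)
      (((hf.mono (Ioi_subset_Ici ht)).stronglyMeasurableAtFilter_nhdsWithin measurableSet_Ioi t))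
      ((hf t ht).mono (Ioi_subset_Ici ht))
  have had : ∀ t, 0 ≤ t → HasDerivWithinAt a (θ * b t) (Ici t) t := fun t ht =>
    (((hderiv b hbc t ht).const_mul θ).const_add 1).congr (fun s hs => ha s (ht.trans hs)) (ha t ht)
  have hbd : ∀ t, 0 ≤ t → HasDerivWithinAt b (θ * a t - 2 * l * b t) (Ici t) t := by
    intro t ht
    have h1 : HasDerivWithinAt (fun t => Real.exp (-(2 * l * t)))
        (Real.exp (-(2 * l * t)) * (-(2 * l))) (Ici t) t := by
      refine HasDerivAt.hasDerivWithinAt (HasDerivAt.exp ?_)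
      simpa using (hasDerivAt_mul_const (x := t) (-(2 * l))).congr_of_eventuallyEq
        (.of_forall fun u => by ring)
    have h2 := h1.mul (((hderiv _ hec t ht).const_mul θ).const_add 1)
    refine (h2.congr (fun s hs => hb s (ht.trans hs)) (hb t ht)).congr_deriv ?_
    have he : Real.exp (-(2 * l * t)) * Real.exp (2 * l * t) = 1 := by
      rw [← Real.exp_add]; simp
    rw [hb t ht]
    linear_combination θ * a t * he
  let v : ℝ × ℝ →L[ℝ] ℝ × ℝ := (θ • ContinuousLinearMap.snd ℝ ℝ ℝ).prod
    (θ • ContinuousLinearMap.fst ℝ ℝ ℝ - (2 * l) • ContinuousLinearMap.snd ℝ ℝ ℝ)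
  -- The matrix of the system has eigenvalues `-l ± r`; these are the components of the solution
  -- starting from `(1, 1)`.
  let A : ℝ → ℝ := fun t =>
    Real.exp (-(l * t)) * (Real.cosh (r * t) + (θ + l) * (Real.sinh (r * t) / r))
  let B : ℝ → ℝ := fun t =>
    Real.exp (-(l * t)) * (Real.cosh (r * t) + (θ - l) * (Real.sinh (r * t) / r))
  have hAB : ∀ κ t, HasDerivAt (fun t => Real.exp (-(l * t)) *
      (Real.cosh (r * t) + κ * (Real.sinh (r * t) / r))) (Real.exp (-(l * t)) *
      ((κ - l) * Real.cosh (r * t) + (r ^ 2 - l * κ) * (Real.sinh (r * t) / r))) t := by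
    intro κ t
    have h0 : HasDerivAt (fun t => r * t) r t := by simpa using (hasDerivAt_id t).const_mul r
    have h1 : HasDerivAt (fun t => -(l * t)) (-l) t := by
      simpa using (hasDerivAt_mul_const (x := t) (-l)).congr_of_eventuallyEq
        (.of_forall fun u => by ring)
    convert! h1.exp.mul (h0.cosh.add ((h0.sinh.div_const r).const_mul κ)) using 1
    field_simp
    simp only [Pi.add_apply]
    field_simp
    ring
  have hsol := ODE_solution_unique (v := fun _ => v) (K := ‖v‖₊) (f := fun t => (a t, b t))
    (g := fun t => (A t, B t)) (a := 0) (b := t) (fun _ => v.lipschitz)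
    ((hac.prodMk hbc).mono Icc_subset_Ici_self)
    (fun s hs => by
      simpa [v] using (had s hs.1).prodMk (hbd s hs.1))
    (by fun_prop)
    (fun s _ => by
      refine (((hAB (θ + l) s).prodMk (hAB (θ - l) s)).congr_deriv ?_).hasDerivWithinAt
      simp only [v, A, B, hr2, ContinuousLinearMap.prod_apply, smul_apply,
        sub_apply, ContinuousLinearMap.coe_fst', ContinuousLinearMap.coe_snd',
        smul_eq_mul, Prod.mk.injEq]
      constructor <;> ring)
    (by simp [A, B, ha 0 le_rfl, hb 0 le_rfl])
  have := hsol (right_mem_Icc.2 ht)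
  simpa [A, B] using this

/-! ### Independence of an increment from the past. -/

/-- Starting the enumeration at the bottom time makes the value of the process at each listed time a
sum of successive increments. -/
lemma Finset.exists_monotone_enumeration {T : Type*} [LinearOrder T] [OrderBot T]
    (I : Finset T) :
    ∃ (τ : ℕ → T) (n : ℕ), Monotone τ ∧ τ 0 = ⊥ ∧ (∀ i ∈ I, ∃ k ≤ n, τ k = i) ∧
      ∀ k, τ k = ⊥ ∨ τ k ∈ I := by
  induction I using Finset.induction_on_max with
  | empty => exact ⟨fun _ => ⊥, 0, monotone_const, rfl, by simp, by simp⟩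
  | insert a I hI ih =>
    obtain ⟨τ, n, hm, h0, hs, hr⟩ := ih
    have hle : ∀ k, τ k ≤ a := fun k => by
      rcases hr k with h | h
      · rw [h]; exact bot_le
      · exact (hI _ h).le
    refine ⟨fun k => if k ≤ n then τ k else a, n + 1, fun i j hij => ?_, by simpa using h0,
      fun i hi => ?_, fun k => ?_⟩
    · dsimp only
      split_ifs with h1 h2 h2
      · exact hm hij
      · exact hle i
      · omega
      · exact le_rfl
    · rcases Finset.mem_insert.1 hi with rfl | hi
      · exact ⟨n + 1, le_rfl, by simp⟩
      · obtain ⟨k, hk, rfl⟩ := hs i hi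
        exact ⟨k, by omega, by simp [hk]⟩
    · dsimp only
      split_ifs
      · rcases hr k with h | h
        · exact .inl h
        · exact .inr (Finset.mem_insert_of_mem h)
      · exact .inr (Finset.mem_insert_self _ _)

section

variable {Ω : Type*} {mΩ : MeasurableSpace Ω} {P : Measure Ω} {N : ℝ≥0 → Ω → ℕ}

/-- For a counting process with independent increments, an increment is independent of the past. -/
lemma indepFun_past_increment [IsProbabilityMeasure P]
    (hind : HasIndepIncrements N P) (hmeas : ∀ t, Measurable (N t)) (hinit : ∀ ω, N 0 ω = 0)
    (hmono : ∀ ω, Monotone fun t => N t ω) {s t : ℝ≥0} (hst : s ≤ t) :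
    IndepFun (fun ω (i : Iic s) => N i ω) (fun ω => N t ω - N s ω) P := by
  refine IndepFun.process_indepFun (fun i => hmeas i)
    ((hmeas t).sub (hmeas s)) fun I => ?_
  obtain ⟨τ, n, hτ, h0, hI, hr⟩ := (I.map (Function.Embedding.subtype _)).exists_monotone_enumeration
  have hle : ∀ k, τ k ≤ s := fun k => by
    rcases hr k with h | h
    · rw [h]; exact bot_le
    · obtain ⟨i, -, hi⟩ := Finset.mem_map.1 h
      rw [← hi]; exact i.2
  -- The grid is continued by `s` and then by `t`: increment `n + 1` is the one over `[s, t]`, and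
  -- those of index below `n` determine the past values.
  let σ : ℕ → ℝ≥0 := fun k => if k ≤ n then τ k else if k = n + 1 then s else t
  have hσ : Monotone σ := fun i j hij => by
    simp only [σ]
    split_ifs with h1 h2 h3 h4 h5 h6 h7
    all_goals first
      | omega
      | exact hτ hij
      | exact hle i
      | exact (hle i).trans hst
      | exact le_rfl
  have hinc := hind.nat hσ
  have h := hinc.indepFun_finset (Finset.range n) {n + 1} (by simp)
    (fun i => (hmeas _).sub (hmeas _))
  have htel : ∀ k ≤ n, ∀ ω, N (τ k) ω = ∑ j ∈ Finset.range k, (N (σ (j + 1)) ω - N (σ j) ω) := by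
    intro k hk ω
    rw [Finset.sum_range_tsub (f := fun j => N (σ j) ω) ((hmono ω).comp hσ)]
    simp [σ, hk, h0, hinit]
  choose! κ hκ hτκ using fun i : I => hI i (Finset.mem_map.2 ⟨i, i.2, rfl⟩)
  have hφ : Measurable fun (x : Finset.range n → ℕ) (i : I) =>
      ∑ j : Finset.range n, if (j : ℕ) < κ i then x j else 0 :=
    measurable_pi_lambda _ fun i => Finset.measurable_sum _ fun j _ => by
      split_ifs <;> fun_prop
  have hψ : Measurable fun (x : ({n + 1} : Finset ℕ) → ℕ) => x ⟨n + 1, by simp⟩ :=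
    measurable_pi_apply _
  convert! h.comp hφ hψ using 1
  · ext ω i
    simp only [Function.comp_apply]
    rw [Finset.sum_coe_sort (Finset.range n)
      (fun j => if j < κ i then N (σ (j + 1)) ω - N (σ j) ω else 0), ← Finset.sum_filter,
      ← hτκ i, htel _ (hκ i)]
    refine Finset.sum_congr ?_ fun _ _ => rfl
    ext j
    have := hκ i
    simp only [Finset.mem_range, Finset.mem_filter]
    omega
  · ext ω
    simp [σ]

/-- This is the Poisson generating function at `-1`: the weight `exp (-m)` times the series of `exp
(-m)`. -/
lemma IsPoissonProcess.integral_neg_one_pow_increment {l : ℝ≥0} (hN : IsPoissonProcess l N P)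
    {s t : ℝ≥0} (hst : s ≤ t) :
    ∫ ω, (-1 : ℝ) ^ (N t ω - N s ω) ∂P = Real.exp (-(2 * l * (t - s))) := by
  have h := (hN.law_increment s t hst).integral_comp (f := fun n : ℕ => (-1 : ℝ) ^ n)
    (by fun_prop)
  simp only [Function.comp_def] at h
  rw [h]
  have hint : Integrable (fun n : ℕ => (-1 : ℝ) ^ n) (poissonMeasure (l * (t - s))) :=
    Integrable.of_bound (by fun_prop) 1 (by simp)
  refine (hasSum_integral_poissonMeasure hint).unique ?_
  have h2 := (NormedSpace.expSeries_div_hasSum_exp (-(l * (t - s) : ℝ))).mul_left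
    (Real.exp (-(l * (t - s) : ℝ)))
  rw [← Real.exp_eq_exp_ℝ, ← Real.exp_add] at h2
  convert! h2 using 1
  · ext n
    simp only [NNReal.coe_mul, NNReal.coe_sub hst, smul_eq_mul, neg_pow (l * (t - s) : ℝ) n]
    ring
  · ring_nf

/-! ### Joint exponential moments of position and sign. -/

variable {l : ℝ≥0}

lemma integral_increment_sign_mul [IsProbabilityMeasure P] (hN : IsPoissonProcess l N P)
    (hinit : ∀ ω, N 0 ω = 0) (hmono : ∀ ω, Monotone fun t => N t ω)
    {s t : ℝ≥0} (hst : s ≤ t) {Z : Ω → ℝ}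
    (hZ : Measurable[MeasurableSpace.comap (fun ω (i : Iic s) => N i ω) inferInstance] Z) :
    ∫ ω, (-1 : ℝ) ^ (N t ω - N s ω) * Z ω ∂P =
      Real.exp (-(2 * l * (t - s))) * ∫ ω, Z ω ∂P := by
  have h1 := indepFun_past_increment hN.indepIncrements hN.measurable hinit hmono hst
  have h2 : IndepFun Z (fun ω => N t ω - N s ω) P :=
    indep_of_indep_of_le_left h1 hZ.comap_le
  have h3 : IndepFun (fun ω => (-1 : ℝ) ^ (N t ω - N s ω)) Z P :=
    (h2.comp measurable_id (measurable_from_top (f := fun n : ℕ => (-1 : ℝ) ^ n))).symm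
  have hpast : Measurable fun ω (i : Iic s) => N i ω :=
    measurable_pi_lambda _ fun i => hN.measurable i
  have hZ' : Measurable Z := hZ.mono hpast.comap_le le_rfl
  have hD : Measurable fun ω => (-1 : ℝ) ^ (N t ω - N s ω) :=
    (measurable_from_top (f := fun n : ℕ => (-1 : ℝ) ^ n)).comp
      ((hN.measurable t).sub (hN.measurable s))
  rw [h3.integral_fun_mul_eq_mul_integral hD.aestronglyMeasurable hZ'.aestronglyMeasurable,
    hN.integral_neg_one_pow_increment hst]

lemma paritySign_eq_increment_mul (hmono : ∀ ω, Monotone fun t => N t ω) {s t : ℝ} (hst : s ≤ t)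
    (ω : Ω) : paritySign N t ω =
      (-1 : ℝ) ^ (N t.toNNReal ω - N s.toNNReal ω) * paritySign N s ω := by
  rw [paritySign, paritySign, ← pow_add,
    Nat.sub_add_cancel (hmono ω (Real.toNNReal_le_toNNReal hst))]

lemma paritySign_mul_self (s : ℝ) (ω : Ω) : paritySign N s ω * paritySign N s ω = 1 := by
  rw [← abs_mul_abs_self, abs_paritySign, one_mul]

lemma abs_exp_mul_unitPosition_le {s T : ℝ} (hs : 0 ≤ s) (hsT : s ≤ T) (θ : ℝ) (ω : Ω) :
    |Real.exp (θ * unitPosition N s ω)| ≤ Real.exp (|θ| * T) := by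
  rw [Real.abs_exp]
  refine Real.exp_le_exp.2 ((le_abs_self _).trans ?_)
  rw [abs_mul]
  exact mul_le_mul_of_nonneg_left ((abs_unitPosition_le hs ω).trans hsT) (abs_nonneg _)

/-- The joint exponential moments of position and parity. -/
lemma integral_exp_unitPosition [IsProbabilityMeasure P] (hN : IsPoissonProcess l N P)
    (hinit : ∀ ω, N 0 ω = 0) (hmono : ∀ ω, Monotone fun t => N t ω)
    (hrc : ∀ ω t, ContinuousWithinAt (fun s => N s ω) (Ici t) t)
    {θ r : ℝ} (hr : r ≠ 0) (hr2 : r ^ 2 = (l : ℝ) ^ 2 + θ ^ 2) {t : ℝ} (ht : 0 ≤ t) :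
    ∫ ω, Real.exp (θ * unitPosition N t ω) ∂P =
      Real.exp (-(l * t)) * (Real.cosh (r * t) + (θ + l) * (Real.sinh (r * t) / r)) ∧
    ∫ ω, paritySign N t ω * Real.exp (θ * unitPosition N t ω) ∂P =
      Real.exp (-(l * t)) * (Real.cosh (r * t) + (θ - l) * (Real.sinh (r * t) / r)) := by
  -- clipping the time at `0` makes the position measurable at negative times too
  let Z : ℝ → Ω → ℝ := fun s ω => Real.exp (θ * unitPosition N (max s 0) ω)
  have hZm : ∀ s, Measurable (Z s) := fun s =>
    ((measurable_unitPosition (le_max_right s 0) (fun u _ => hN.measurable u) hrc).const_mul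
      θ).exp
  have hεm : ∀ s, Measurable (paritySign N s) := fun s => measurable_paritySign (hN.measurable _)
  have hZc : ∀ ω, Continuous fun s => Z s ω := fun ω => by
    have := continuous_unitPosition hrc ω
    fun_prop
  have hZ0 : ∀ s, 0 ≤ s → ∀ ω, Z s ω = Real.exp (θ * unitPosition N s ω) := fun s hs ω => by
    simp only [Z, max_eq_left hs]
  have hZb : ∀ T, ∀ s ∈ Ioc 0 T, ∀ ω, |Z s ω| ≤ Real.exp (|θ| * T) := fun T s hs ω => by
    rw [hZ0 s hs.1.le]; exact abs_exp_mul_unitPosition_le hs.1.le hs.2 θ ω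
  have hεZb : ∀ T, ∀ s ∈ Ioc 0 T, ∀ ω, |paritySign N s ω * Z s ω| ≤ Real.exp (|θ| * T) :=
    fun T s hs ω => by rw [abs_mul, abs_paritySign, one_mul]; exact hZb T s hs ω
  have hεZc : ∀ ω s, ContinuousWithinAt (fun u => paritySign N u ω * Z u ω) (Ici s) s :=
    fun ω s => (paritySign_rightCont hrc ω s).mul (hZc ω).continuousWithinAt
  have hεZi : ∀ T, 0 ≤ T → Integrable (Function.uncurry fun s ω => paritySign N s ω * Z s ω)
      ((volume.restrict (uIoc 0 T)).prod P) := fun T hT =>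
    integrable_uncurry_of_rightCont hT (fun s _ => (hεm s).mul (hZm s)) hεZc (hεZb T)
  have hexp : ∀ T, 0 ≤ T → ∀ ω,
      Z T ω = 1 + θ * ∫ s in 0..T, paritySign N s ω * Z s ω := fun T hT ω => by
    rw [hZ0 T hT, exp_unitPosition_eq hrc]
    congr 2
    refine intervalIntegral.integral_congr fun s hs => ?_
    rw [uIcc_of_le hT] at hs
    simp only [hZ0 s hs.1]
  have hεint : ∀ T, Integrable (paritySign N T) P := fun T =>
    Integrable.of_bound (hεm T).aestronglyMeasurable 1
      (.of_forall fun ω => (abs_paritySign N T ω).le)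
  have hprimi : ∀ T, 0 ≤ T →
      Integrable (fun ω => ∫ s in 0..T, paritySign N s ω * Z s ω) P := fun T hT => by
    have := (hεZi T hT).integral_prod_right
    simpa only [intervalIntegral.integral_of_le hT, uIoc_of_le hT, Function.uncurry] using this
  -- Since `ε_s² = 1`, the factor `ε_T ε_s` is the sign of the increment over `[s, T]`, while `Z s`
  -- is measurable with respect to the past of `s`.
  have hDi : ∀ T, 0 ≤ T → ∀ s ∈ Icc 0 T,
      ∫ ω, paritySign N T ω * (paritySign N s ω * Z s ω) ∂P =
        Real.exp (-(2 * l * (T - s))) * ∫ ω, Z s ω ∂P := by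
    intro T hT s hs
    rw [← Real.coe_toNNReal T hT, ← Real.coe_toNNReal s hs.1,
      ← integral_increment_sign_mul hN hinit hmono (Real.toNNReal_le_toNNReal hs.2)]
    · refine integral_congr_ae (.of_forall fun ω => ?_)
      simp only [Real.coe_toNNReal T hT, Real.coe_toNNReal s hs.1]
      rw [paritySign_eq_increment_mul hmono hs.2]
      linear_combination (-1 : ℝ) ^ (N T.toNNReal ω - N s.toNNReal ω) * Z s ω *
        paritySign_mul_self (N := N) s ω
    · rw [Real.coe_toNNReal s hs.1]
      refine ((@measurable_unitPosition Ω N (MeasurableSpace.comap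
        (fun ω (i : Iic s.toNNReal) => N i ω) inferInstance) (max s 0) (le_max_right s 0)
          (fun u hu => ?_) hrc).const_mul θ).exp
      rw [max_eq_left hs.1] at hu
      exact (measurable_pi_apply (⟨u, hu⟩ : Iic s.toNNReal)).comp
        (comap_measurable fun ω (i : Iic s.toNNReal) => N i ω)
  have hsol := eq_of_telegraph_integral_equations (a := fun s => ∫ ω, Z s ω ∂P)
    (b := fun s => ∫ ω, paritySign N s ω * Z s ω ∂P) (θ := θ) (l := l) hr hr2 ?_ ?_ ?_ ht
  · simpa only [hZ0 t ht] using hsol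
  · intro T hT
    rw [intervalIntegrable_iff]
    exact (hεZi T hT).integral_prod_left
  · intro T hT
    rw [intervalIntegral_integral_swap (hεZi T hT)]
    simp only [hexp T hT]
    rw [integral_add (integrable_const _) ((hprimi T hT).const_mul θ), integral_const_mul]
    simp
  · intro T hT
    have h1 : ∫ ω, paritySign N T ω ∂P = Real.exp (-(2 * l * T)) := by
      have := hN.integral_neg_one_pow_increment (zero_le (a := T.toNNReal))
      simpa [hinit, paritySign, hT] using this
    have h2 : ∫ ω, paritySign N T ω * (∫ s in 0..T, paritySign N s ω * Z s ω) ∂P =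
        ∫ s in 0..T, Real.exp (-(2 * l * (T - s))) * ∫ ω, Z s ω ∂P := by
      simp_rw [← intervalIntegral.integral_const_mul]
      rw [← intervalIntegral_integral_swap]
      · refine intervalIntegral.integral_congr fun s hs => ?_
        rw [uIcc_of_le hT] at hs
        exact hDi T hT s hs
      · refine integrable_uncurry_of_rightCont (C := Real.exp (|θ| * T)) hT
          (fun s _ => (hεm T).mul ((hεm s).mul (hZm s)))
          (fun ω s => continuousWithinAt_const.mul (hεZc ω s)) fun s hs ω => ?_
        rw [abs_mul, abs_paritySign, one_mul]
        exact hεZb T s hs ω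
    have h3 : Integrable
        (fun ω => paritySign N T ω * ∫ s in 0..T, paritySign N s ω * Z s ω) P :=
      (hprimi T hT).bdd_mul (hεm T).aestronglyMeasurable
        (.of_forall fun ω => (abs_paritySign N T ω).le)
    -- The integral equation for `Z` is multiplied by the terminal sign before averaging, so the
    -- increments over `[s, T]` appear under the integral.
    have h4 : ∀ ω, paritySign N T ω * Z T ω = paritySign N T ω +
        θ * (paritySign N T ω * ∫ s in 0..T, paritySign N s ω * Z s ω) := fun ω => by
      rw [hexp T hT]; ring
    simp only [h4]
    rw [integral_add (hεint T) (h3.const_mul θ), integral_const_mul, h1, h2, mul_add, mul_one,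
      mul_left_comm, ← intervalIntegral.integral_const_mul (Real.exp _)]
    congr 2
    refine intervalIntegral.integral_congr fun s _ => ?_
    rw [← mul_assoc, ← Real.exp_add]
    ring_nf

end

/-! ### Identification of the conditional laws. -/

section

variable {Ω : Type*} {mΩ : MeasurableSpace Ω} {P : Measure Ω} {N : ℝ≥0 → Ω → ℕ} {l : ℝ≥0}

/-- A Poisson process has a modification all of whose paths are regular. -/
lemma IsPoissonProcess.exists_regular_modification (hN : IsPoissonProcess l N P) :
    ∃ N' : ℝ≥0 → Ω → ℕ, IsPoissonProcess l N' P ∧ (∀ ω, N' 0 ω = 0) ∧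
      (∀ ω, Monotone fun t => N' t ω) ∧
      (∀ ω t, ContinuousWithinAt (fun s => N' s ω) (Ici t) t) ∧ ∀ᵐ ω ∂P, ∀ t, N t ω = N' t ω := by
  have hgood := hN.init.and (hN.mono.and hN.rightCont)
  obtain ⟨G, hG, hGm, hGP⟩ := exists_measurable_superset_of_null (ae_iff.1 hgood)
  have hGood : ∀ ω ∉ G, N 0 ω = 0 ∧ (Monotone fun t => N t ω) ∧
      ∀ t, ContinuousWithinAt (fun s => N s ω) (Ici t) t := fun ω hω => by
    by_contra h
    exact hω (hG h)
  classical
  -- The irregular paths lie in a measurable null set `G`, where they are replaced by the zero path.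
  let N' : ℝ≥0 → Ω → ℕ := fun t ω => if ω ∈ G then 0 else N t ω
  have hae : ∀ᵐ ω ∂P, ∀ t, N t ω = N' t ω := by
    filter_upwards [compl_mem_ae_iff.2 hGP] with ω hω t
    have : ω ∉ G := hω
    simp [N', this]
  have h0 : ∀ ω, N' 0 ω = 0 := fun ω => by
    by_cases h : ω ∈ G
    · simp [N', h]
    · simp [N', h, (hGood ω h).1]
  have hm : ∀ ω, Monotone fun t => N' t ω := fun ω => by
    by_cases h : ω ∈ G
    · simpa [N', h] using monotone_const
    · simpa [N', h] using (hGood ω h).2.1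
  have hc : ∀ ω t, ContinuousWithinAt (fun s => N' s ω) (Ici t) t := fun ω => by
    by_cases h : ω ∈ G
    · simpa [N', h] using fun t => continuousWithinAt_const
    · simpa [N', h] using (hGood ω h).2.2
  refine ⟨N', ⟨fun t => Measurable.ite hGm measurable_const (hN.measurable t), .of_forall h0,
    .of_forall hm, .of_forall hc, fun n t ht => ?_, fun s t hst => ?_⟩, h0, hm, hc, hae⟩
  · refine (hN.indepIncrements n t ht).congr fun i => ?_
    filter_upwards [hae] with ω hω
    rw [hω, hω]
  · refine (hN.law_increment s t hst).congr ?_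
    filter_upwards [hae] with ω hω
    rw [hω, hω]

/-- The indicator of the event equals `(1 + κ ε) / 2`, because `ε` takes only the values `±1`. -/
lemma setIntegral_paritySign_eq [IsProbabilityMeasure P] {t κ : ℝ} (hκ : κ = 1 ∨ κ = -1)
    (hε : Measurable (paritySign N t)) {Z : Ω → ℝ} (hZ : Integrable Z P) :
    ∫ ω in {ω | paritySign N t ω = κ}, Z ω ∂P =
      (∫ ω, Z ω ∂P + κ * ∫ ω, paritySign N t ω * Z ω ∂P) / 2 := by
  have hs : MeasurableSet {ω | paritySign N t ω = κ} := hε (measurableSet_singleton κ)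
  have hεZ : Integrable (fun ω => paritySign N t ω * Z ω) P :=
    hZ.bdd_mul hε.aestronglyMeasurable (.of_forall fun ω => (abs_paritySign N t ω).le)
  rw [← integral_indicator hs, ← integral_const_mul, ← integral_add hZ (hεZ.const_mul κ),
    ← integral_div]
  refine integral_congr_ae (.of_forall fun ω => ?_)
  have h := (abs_eq zero_le_one).1 (abs_paritySign N t ω)
  simp only [indicator, mem_ofPred_eq]
  rcases h with h | h <;> rcases hκ with rfl | rfl <;> simp [h] <;> norm_num

/-- The joint law of the scaled position and the parity at a fixed time. -/
noncomputable def positionLaw (P : Measure Ω) (N : ℝ≥0 → Ω → ℕ) (t κ w : ℝ) : Measure ℝ :=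
  (P.restrict {ω | paritySign N t ω = κ}).map fun ω => w * unitPosition N t ω

lemma mgf_positionLaw [IsProbabilityMeasure P] (hN : IsPoissonProcess l N P)
    (hinit : ∀ ω, N 0 ω = 0) (hmono : ∀ ω, Monotone fun t => N t ω)
    (hrc : ∀ ω t, ContinuousWithinAt (fun s => N s ω) (Ici t) t)
    {θ w r t κ : ℝ} (hr : r ≠ 0) (hr2 : r ^ 2 = (l : ℝ) ^ 2 + (θ * w) ^ 2) (ht : 0 ≤ t)
    (hκ : κ = 1 ∨ κ = -1) :
    mgf id (positionLaw P N t κ w) θ = Real.exp (-(l * t)) *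
      ((1 + κ) / 2 * (Real.cosh (r * t) + θ * w * (Real.sinh (r * t) / r)) +
        (1 - κ) / 2 * (l * (Real.sinh (r * t) / r))) := by
  have hS : Measurable (unitPosition N t) :=
    measurable_unitPosition ht (fun s _ => hN.measurable s) hrc
  have hZ : Integrable (fun ω => Real.exp (θ * w * unitPosition N t ω)) P :=
    Integrable.of_bound (by fun_prop) _
      (.of_forall fun ω => abs_exp_mul_unitPosition_le ht le_rfl (θ * w) ω)
  have h := integral_exp_unitPosition hN hinit hmono hrc hr hr2 ht
  rw [positionLaw, mgf, integral_map (by fun_prop) (by fun_prop)]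
  simp only [id, ← mul_assoc]
  rw [setIntegral_paritySign_eq hκ (measurable_paritySign (hN.measurable _)) hZ, h.1, h.2]
  rcases hκ with rfl | rfl <;> ring

lemma ae_abs_le_positionLaw (hN : IsPoissonProcess l N P)
    (hrc : ∀ ω t, ContinuousWithinAt (fun s => N s ω) (Ici t) t) {t : ℝ} (ht : 0 ≤ t) (κ w : ℝ) :
    ∀ᵐ x ∂positionLaw P N t κ w, |x| ≤ |w| * t := by
  have hS : Measurable (unitPosition N t) :=
    measurable_unitPosition ht (fun s _ => hN.measurable s) hrc
  rw [positionLaw, ae_map_iff (by fun_prop) (measurableSet_le measurable_abs measurable_const)]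
  refine .of_forall fun ω => ?_
  rw [abs_mul]
  exact mul_le_mul_of_nonneg_left (abs_unitPosition_le ht ω) (abs_nonneg w)

variable [IsProbabilityMeasure P]

lemma isFiniteMeasure_positionLaw (t κ w : ℝ) : IsFiniteMeasure (positionLaw P N t κ w) :=
  Measure.isFiniteMeasure_map _ _

/-- With `μ = l / c`, `R = c t` and `q = r / c` one has `q R = r t`, and the transform of the Dirac
mass cancels the exponential subtracted in `mgf_sameVelocityDensity`. -/
lemma positionLaw_one (hN : IsPoissonProcess l N P) (hl : 0 < l)
    (hinit : ∀ ω, N 0 ω = 0) (hmono : ∀ ω, Monotone fun t => N t ω)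
    (hrc : ∀ ω t, ContinuousWithinAt (fun s => N s ω) (Ici t) t)
    {c t v s : ℝ} (hc : 0 < c) (ht : 0 ≤ t) (hs : s = -1 ∨ s = 1) (hv : v = s * c) :
    positionLaw P N t 1 v = ENNReal.ofReal (Real.exp (-(l * t))) •
      (Measure.dirac (v * t) + (volume.restrict (Ioo (-(c * t)) (c * t))).withDensity fun x =>
        ENNReal.ofReal (sameVelocityDensity (l / c) (c * t) s x)) := by
  have hl' : (0 : ℝ) < l := hl
  have hs2 : s ^ 2 = 1 := by rcases hs with rfl | rfl <;> norm_num
  have hd := isFiniteMeasure_withDensity_restrict_Ioo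
    (continuous_sameVelocityDensity (l / c) (c * t) s) (c * t)
  have hp := isFiniteMeasure_positionLaw (P := P) (N := N) t 1 v
  have : IsFiniteMeasure (ENNReal.ofReal (Real.exp (-(l * t))) •
      (Measure.dirac (v * t) + (volume.restrict (Ioo (-(c * t)) (c * t))).withDensity fun x =>
        ENNReal.ofReal (sameVelocityDensity (l / c) (c * t) s x))) :=
    Measure.smul_finite _ ENNReal.ofReal_ne_top
  refine Measure.ext_of_mgf_of_ae_abs_le (ae_abs_le_positionLaw hN hrc ht 1 v) (funext fun θ => ?_)
  have hpos : 0 < (l : ℝ) ^ 2 + (θ * v) ^ 2 := by positivity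
  obtain ⟨r, hr, hr2⟩ : ∃ r : ℝ, r ≠ 0 ∧ r ^ 2 = (l : ℝ) ^ 2 + (θ * v) ^ 2 :=
    ⟨_, (Real.sqrt_pos.2 hpos).ne', Real.sq_sqrt hpos.le⟩
  rw [mgf_positionLaw hN hinit hmono hrc hr hr2 ht (.inl rfl),
    mgf_id_smul_dirac_add _ _ _ _ (ae_abs_le_withDensity_restrict_Ioo _ _),
    mgf_sameVelocityDensity (by positivity) hs (q := r / c) (by positivity),
    ENNReal.toReal_ofReal (Real.exp_pos _).le, hv]
  · field_simp
    ring_nf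
  · rw [div_pow, hr2, hv]
    field_simp
    rw [hs2]
    ring

lemma positionLaw_neg_one (hN : IsPoissonProcess l N P) (hl : 0 < l)
    (hinit : ∀ ω, N 0 ω = 0) (hmono : ∀ ω, Monotone fun t => N t ω)
    (hrc : ∀ ω t, ContinuousWithinAt (fun s => N s ω) (Ici t) t)
    {c t v : ℝ} (hc : 0 < c) (ht : 0 ≤ t) (hv : |v| = c) :
    positionLaw P N t (-1) v = ENNReal.ofReal (Real.exp (-(l * t))) •
      (volume.restrict (Ioo (-(c * t)) (c * t))).withDensity fun x =>
        ENNReal.ofReal (oppositeVelocityDensity (l / c) (c * t) x) := by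
  have hl' : (0 : ℝ) < l := hl
  have hd := isFiniteMeasure_withDensity_restrict_Ioo
    (continuous_oppositeVelocityDensity (l / c) (c * t)) (c * t)
  have hp := isFiniteMeasure_positionLaw (P := P) (N := N) t (-1) v
  have : IsFiniteMeasure (ENNReal.ofReal (Real.exp (-(l * t))) •
      (volume.restrict (Ioo (-(c * t)) (c * t))).withDensity fun x =>
        ENNReal.ofReal (oppositeVelocityDensity (l / c) (c * t) x)) :=
    Measure.smul_finite _ ENNReal.ofReal_ne_top
  refine Measure.ext_of_mgf_of_ae_abs_le (ae_abs_le_positionLaw hN hrc ht (-1) v)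
    (funext fun θ => ?_)
  have hpos : 0 < (l : ℝ) ^ 2 + (θ * v) ^ 2 := by positivity
  obtain ⟨r, hr, hr2⟩ : ∃ r : ℝ, r ≠ 0 ∧ r ^ 2 = (l : ℝ) ^ 2 + (θ * v) ^ 2 :=
    ⟨_, (Real.sqrt_pos.2 hpos).ne', Real.sq_sqrt hpos.le⟩
  rw [mgf_positionLaw hN hinit hmono hrc hr hr2 ht (.inr rfl), mgf_smul_measure,
    mgf_oppositeVelocityDensity (by positivity) (by positivity) (q := r / c) (by positivity),
    ENNReal.toReal_ofReal (Real.exp_pos _).le]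
  · field_simp
    ring_nf
  · rw [div_pow, hr2, mul_pow, ← sq_abs v, hv]
    field_simp

lemma telegraphPosition_eq (V₀ : Ω → ℝ) (t : ℝ≥0) (ω : Ω) :
    telegraphPosition V₀ N t ω = V₀ ω * unitPosition N t ω := by
  simp [telegraphPosition, telegraphVelocity, unitPosition, paritySign]

/-- Given the initial velocity, the joint law of position and velocity is that of the scaled
unit-speed process. -/
lemma cond_telegraph_eq_positionLaw {N' : ℝ≥0 → Ω → ℕ} (hN : IsPoissonProcess l N P)
    (hN' : IsPoissonProcess l N' P) (hinit : ∀ ω, N' 0 ω = 0)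
    (hrc : ∀ ω t, ContinuousWithinAt (fun s => N' s ω) (Ici t) t)
    (hae : ∀ᵐ ω ∂P, ∀ t, N t ω = N' t ω) {V₀ : Ω → ℝ} (hV₀ : Measurable V₀)
    (hindep : IndepFun V₀ (fun ω t => N t ω) P) {w κ : ℝ} (hw : w ≠ 0)
    (hPw : P {ω | V₀ ω = w} ≠ 0) (t : ℝ≥0) {B : Set ℝ} (hB : MeasurableSet B) :
    P[|{ω | telegraphVelocity V₀ N 0 ω = w}]
      {ω | telegraphPosition V₀ N t ω ∈ B ∧ telegraphVelocity V₀ N t ω = w * κ} =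
      positionLaw P N' t κ w B := by
  have hA : MeasurableSet {ω | telegraphVelocity V₀ N 0 ω = w} :=
    (hV₀.mul ((measurable_from_top (f := fun n : ℕ => (-1 : ℝ) ^ n)).comp (hN.measurable 0)))
      (measurableSet_singleton w)
  have hε : Measurable (paritySign N' (t : ℝ)) := measurable_paritySign (hN'.measurable _)
  have hS : Measurable (unitPosition N' (t : ℝ)) :=
    measurable_unitPosition t.coe_nonneg (fun s _ => hN'.measurable s) hrc
  have h1 : {ω | telegraphVelocity V₀ N 0 ω = w} =ᵐ[P] {ω | V₀ ω = w} := by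
    filter_upwards [hae] with ω hω
    apply propext
    change telegraphVelocity V₀ N 0 ω = w ↔ V₀ ω = w
    simp [telegraphVelocity, hω, hinit]
  -- On `V₀ = w` the target event becomes `E`, which depends on `N'` alone and is therefore
  -- independent of `V₀`.
  let E : Set Ω := {ω | w * unitPosition N' t ω ∈ B ∧ paritySign N' t ω = κ}
  have h2 : ({ω | telegraphVelocity V₀ N 0 ω = w} ∩
      {ω | telegraphPosition V₀ N t ω ∈ B ∧ telegraphVelocity V₀ N t ω = w * κ} : Set Ω)
      =ᵐ[P] ({ω | V₀ ω = w} ∩ E : Set Ω) := by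
    filter_upwards [hae] with ω hω
    apply propext
    change (telegraphVelocity V₀ N 0 ω = w ∧ telegraphPosition V₀ N t ω ∈ B ∧
      telegraphVelocity V₀ N t ω = w * κ) ↔
      (V₀ ω = w ∧ w * unitPosition N' t ω ∈ B ∧ paritySign N' t ω = κ)
    have hpos : unitPosition N t ω = unitPosition N' t ω := by
      simp [unitPosition, paritySign, hω]
    rw [telegraphPosition_eq, hpos]
    simp only [telegraphVelocity, hω, hinit, pow_zero, mul_one, paritySign, Real.toNNReal_coe]
    refine and_congr_right fun h => ?_
    rw [h, mul_right_inj' hw]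
  have hindep' : IndepFun V₀ (fun ω t => N' t ω) P :=
    hindep.congr .rfl (hae.mono fun ω hω => funext hω)
  have hE : MeasurableSet[MeasurableSpace.comap (fun ω t => N' t ω) inferInstance] E := by
    have hmeas : ∀ s, Measurable[MeasurableSpace.comap (fun ω t => N' t ω) inferInstance]
        (N' s) := fun s =>
      (measurable_pi_apply s).comp (comap_measurable fun ω t => N' t ω)
    refine MeasurableSet.inter ?_ ?_
    · exact ((@measurable_unitPosition Ω N' (MeasurableSpace.comap (fun ω t => N' t ω)
        inferInstance) t t.coe_nonneg (fun s _ => hmeas s) hrc).const_mul w) hB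
    · exact @measurable_paritySign Ω N' (MeasurableSpace.comap (fun ω t => N' t ω)
        inferInstance) t (hmeas _) _ (measurableSet_singleton κ)
  have h3 : P ({ω | V₀ ω = w} ∩ E) = P {ω | V₀ ω = w} * P E :=
    (Indep_iff _ _ _).1 hindep' _ _ ⟨{w}, measurableSet_singleton w, rfl⟩ hE
  rw [cond_apply hA, measure_congr h1, measure_congr h2, h3, ← mul_assoc,
    ENNReal.inv_mul_cancel hPw (measure_ne_top _ _), one_mul, positionLaw,
    Measure.map_apply (by fun_prop) hB, Measure.restrict_apply ((hS.const_mul w) hB)]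
  rfl

end

end

theorem theorem1 {Ω : Type*} [MeasurableSpace Ω] (P : Measure Ω) [IsProbabilityMeasure P]
    (c : ℝ) (hc : 0 < c) (lam : ℝ≥0) (hlam : 0 < lam)
    (N : ℝ≥0 → Ω → ℕ) (hN : IsPoissonProcess lam N P)
    (V₀ : Ω → ℝ) (hV₀ : Measurable V₀) (hV₀law : HasLaw V₀ (uniformOn {-c, c}) P)
    (hindep : IndepFun V₀ (fun ω t => N t ω) P)
    (t : ℝ≥0) (v : ℝ) (hv : v ∈ ({-c, c} : Set ℝ)) :
    (∀ B : Set ℝ, MeasurableSet B →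
      P[|{ω | telegraphVelocity V₀ N 0 ω = v}]
          {ω | telegraphPosition V₀ N t ω ∈ B ∧ telegraphVelocity V₀ N t ω = v} =
        (ENNReal.ofReal (Real.exp (-(lam * t))) •
          (Measure.dirac (v * t) +
            volume.withDensity ({x : ℝ | |x| < c * t}.indicator fun x =>
              ENNReal.ofReal (lam / (2 * c) * (c * t + x * Real.sign v) *
                (besselI 1 (lam / c * √(c ^ 2 * t ^ 2 - x ^ 2)) /
                  √(c ^ 2 * t ^ 2 - x ^ 2)))))) B) ∧
    (∀ B : Set ℝ, MeasurableSet B →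
      P[|{ω | telegraphVelocity V₀ N 0 ω = -v}]
          {ω | telegraphPosition V₀ N t ω ∈ B ∧ telegraphVelocity V₀ N t ω = v} =
        (ENNReal.ofReal (Real.exp (-(lam * t))) •
          volume.withDensity ({x : ℝ | |x| < c * t}.indicator fun x =>
            ENNReal.ofReal (lam / (2 * c) *
              besselI 0 (lam / c * √(c ^ 2 * t ^ 2 - x ^ 2))))) B) := by
  obtain ⟨N', hN', hinit, hmono, hrc, hae⟩ := hN.exists_regular_modification
  have hatom : ∀ w ∈ ({-c, c} : Set ℝ), P {ω | V₀ ω = w} ≠ 0 := fun w hw => by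
    have := hV₀law.measure_eq (p := (· = w)) (measurableSet_singleton w)
    rw [this, Ne, uniformOn_eq_zero_iff (by simp)]
    exact Set.nonempty_iff_ne_empty.1 ⟨w, hw, rfl⟩
  have hsign : (Real.sign v = -1 ∨ Real.sign v = 1) ∧ v = Real.sign v * c := by
    rcases hv with rfl | rfl
    · simp [Real.sign_of_neg (neg_neg_of_pos hc)]
    · simp [Real.sign_of_pos hc]
  have habs : |-v| = c := by
    rw [abs_neg]
    rcases hv with rfl | rfl
    · rw [abs_neg, abs_of_pos hc]
    · exact abs_of_pos hc
  have hv0 : v ≠ 0 := by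
    rintro rfl
    simp [hc.ne] at habs
  have hnv : -v ∈ ({-c, c} : Set ℝ) := by
    rcases hv with rfl | rfl <;> simp
  constructor
  · intro B hB
    have h := cond_telegraph_eq_positionLaw (κ := 1) hN hN' hinit hrc hae hV₀ hindep hv0
      (hatom v hv) t hB
    rw [mul_one] at h
    rw [h, positionLaw_one hN' hlam hinit hmono hrc hc t.coe_nonneg hsign.1 hsign.2,
      withDensity_indicator_abs_lt (g := sameVelocityDensity (lam / c) (c * t) (Real.sign v))]
    intro x hx
    rw [← mul_pow, besselI_one_mul_sqrt_div hx, sameVelocityDensity]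
    ring
  · intro B hB
    -- Starting from `-v`, the velocity at time `t` is `v` exactly when the sign is `-1`.
    have h := cond_telegraph_eq_positionLaw (κ := -1) hN hN' hinit hrc hae hV₀ hindep
      (neg_ne_zero.2 hv0) (hatom _ hnv) t hB
    rw [neg_mul_neg, mul_one] at h
    rw [h, positionLaw_neg_one hN' hlam hinit hmono hrc hc t.coe_nonneg habs,
      withDensity_indicator_abs_lt (g := oppositeVelocityDensity (lam / c) (c * t))]
    intro x hx
    rw [← mul_pow, besselI_zero_mul_sqrt hx, oppositeVelocityDensity]
    ring
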